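/- **Lemma 2.3 (LocProj).** Let $\mathbb{S}^3\subset\mathbb{R}^4$ be the unit sphere with its surface measure $\nu_g$ and geodesic distance $d_g(P,Q)=\angle(P,Q)$, and let $B(P,r)=\{Q\in\mathbb{S}^3: d_g(P,Q)<r\}$. For an integer $q\ge 1$ let $\pi_q$ be the orthogonal projection of $L^2(\mathbb{S}^3)=L^2(\mathbb{S}^3,\nu_g;\mathbb{C})$ onto the space of spherical harmonics of degree $q-1$, i.e. restrictions to $\mathbb{S}^3$ of the homogeneous harmonic polynomials of degree $q-1$ on $\mathbb{R}^4$ (the eigenspace of $-\Delta_{\mathbb{S}^3}+1$ with eigenvalue $q^2$). Then there is a constant $C>0$ such that for every dyadic integer $N\ge 1$ (i.e. $N=2^k$, $k\in\{0,1,2,\dots\}$), every $P\in\mathbb{S}^3$ and every integer $q\ge 1$, $$\big\Vert \mathbf{1}_{B(P,N^{-1})}\,\pi_q\big\Vert_{L^2\to L^2}=\big\Vert \pi_q\big[\mathbf{1}_{B(P,N^{-1})}\,\cdot\,\big]\big\Vert_{L^2\to L^2}\le C\left(N^{-1/2}+q^{-2}\right).$$ -/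

import Mathlib

open MeasureTheory
open scoped ENNReal

noncomputable section

namespace SphereCluster

/-- The unit sphere `S³` of `ℝ⁴`. -/
abbrev S3 : Type := Metric.sphere (0 : EuclideanSpace ℝ (Fin 4)) 1

/-- The surface measure on `S³` (rotation invariant, of total mass `2π²`). -/
def surf : Measure S3 := (volume : Measure (EuclideanSpace ℝ (Fin 4))).toSphere

instance : IsFiniteMeasure surf :=
  inferInstanceAs (IsFiniteMeasure (volume : Measure (EuclideanSpace ℝ (Fin 4))).toSphere)

/-- The complex Hilbert space `L²(S³)`. -/
abbrev L2 : Type := Lp ℂ 2 surf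

/-- The geodesic ball: points `Q` of `S³` whose geodesic distance to `P`, which is the angle
between the rays from the origin through `P` and `Q`, is less than `r`. -/
def geoBall (P : S3) (r : ℝ) : Set S3 :=
  {Q | InnerProductGeometry.angle (P : EuclideanSpace ℝ (Fin 4)) Q < r}

theorem measurableSet_geoBall (P : S3) (r : ℝ) : MeasurableSet (geoBall P r) := by
  have h : Continuous fun Q : S3 =>
      InnerProductGeometry.angle (P : EuclideanSpace ℝ (Fin 4)) Q := by
    unfold InnerProductGeometry.angle
    refine Real.continuous_arccos.comp ?_
    have h1 : ∀ Q : S3, ‖(Q : EuclideanSpace ℝ (Fin 4))‖ = 1 := fun Q => by simp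
    simp only [h1]
    fun_prop
  exact (isOpen_lt h continuous_const).measurableSet

/-- The product `1_A f` of an `L²` function with the indicator function of a measurable set. -/
def indicatorMul (A : Set S3) (hA : MeasurableSet A) (f : L2) : L2 :=
  ((Lp.memLp f).indicator hA).toLp (A.indicator f)

theorem coeFn_indicatorMul (A : Set S3) (hA : MeasurableSet A) (f : L2) :
    indicatorMul A hA f =ᵐ[surf] A.indicator f := by
  have h := (Lp.memLp f).indicator hA
  exact MemLp.coeFn_toLp h

/-- Multiplication by the indicator function of a measurable set, as a bounded operator on
`L²(S³)`. -/
def mulIndicator (A : Set S3) (hA : MeasurableSet A) : L2 →L[ℂ] L2 :=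
  LinearMap.mkContinuous
    { toFun := indicatorMul A hA
      map_add' := fun f g => by
        refine Lp.ext ?_
        filter_upwards [coeFn_indicatorMul A hA (f + g), coeFn_indicatorMul A hA f,
          coeFn_indicatorMul A hA g, Lp.coeFn_add f g,
          Lp.coeFn_add (indicatorMul A hA f) (indicatorMul A hA g)] with x h1 h2 h3 h4 h5
        rw [h5, Pi.add_apply, h1, h2, h3]
        by_cases h : x ∈ A
        · simpa only [Set.indicator_of_mem h, Pi.add_apply] using h4
        · simp only [Set.indicator_of_notMem h, add_zero]
      map_smul' := fun c f => by
        refine Lp.ext ?_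
        filter_upwards [coeFn_indicatorMul A hA (c • f), coeFn_indicatorMul A hA f,
          Lp.coeFn_smul c f, Lp.coeFn_smul c (indicatorMul A hA f)] with x h1 h2 h3 h4
        rw [RingHom.id_apply, h4, Pi.smul_apply, h1, h2]
        by_cases h : x ∈ A
        · simpa only [Set.indicator_of_mem h, Pi.smul_apply] using h3
        · simp only [Set.indicator_of_notMem h, smul_zero] }
    1 (fun f => by
      rw [one_mul]
      refine Lp.norm_le_norm_of_ae_le ?_
      filter_upwards [coeFn_indicatorMul A hA f] with x h1
      exact (congrArg norm h1).trans_le (norm_indicator_le_norm_self _ _))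

theorem mulIndicator_apply (A : Set S3) (hA : MeasurableSet A) (f : L2) :
    mulIndicator A hA f = indicatorMul A hA f := rfl

/-- The operator `f ↦ 1_{B(P, r)} f` on `L²(S³)`. -/
def ballCutoff (P : S3) (r : ℝ) : L2 →L[ℂ] L2 :=
  mulIndicator (geoBall P r) (measurableSet_geoBall P r)

/-- The Laplacian `∑ᵢ ∂ᵢ²` on polynomials in four variables. -/
def polyLaplacian : MvPolynomial (Fin 4) ℂ →ₗ[ℂ] MvPolynomial (Fin 4) ℂ :=
  ∑ i : Fin 4, (MvPolynomial.pderiv i).toLinearMap ∘ₗ (MvPolynomial.pderiv i).toLinearMap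

/-- Restriction of a complex polynomial in four variables to `S³ ⊆ ℝ⁴`. -/
def polyRestrict : MvPolynomial (Fin 4) ℂ →ₗ[ℂ] C(S3, ℂ) where
  toFun p := ⟨fun x => MvPolynomial.eval (fun i => ((x.1 i : ℝ) : ℂ)) p,
    (MvPolynomial.continuous_eval p).comp (by fun_prop)⟩
  map_add' p q := by ext x; simp
  map_smul' c p := by ext x; simp [MvPolynomial.smul_eval]

/-- The harmonic homogeneous polynomials of degree `d` in four variables. -/
def harmonicPoly (d : ℕ) : Submodule ℂ (MvPolynomial (Fin 4) ℂ) :=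
  MvPolynomial.homogeneousSubmodule (Fin 4) ℂ d ⊓ LinearMap.ker polyLaplacian

/-- The spherical harmonics of degree `d` on `S³`, as a subspace of `L²(S³)`: the restrictions
to `S³` of the harmonic homogeneous polynomials of degree `d`. -/
def sphericalHarmonics (d : ℕ) : Submodule ℂ L2 :=
  (harmonicPoly d).map ((ContinuousMap.toLp 2 surf ℂ).toLinearMap ∘ₗ polyRestrict)

instance finiteDimensional_harmonicPoly (d : ℕ) : FiniteDimensional ℂ (harmonicPoly d) := by
  have h : harmonicPoly d ≤ MvPolynomial.restrictTotalDegree (Fin 4) ℂ d := fun p hp =>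
    (MvPolynomial.mem_restrictTotalDegree _ _ _).2
      (MvPolynomial.IsHomogeneous.totalDegree_le ((MvPolynomial.mem_homogeneousSubmodule d p).1 hp.1))
  exact Submodule.finiteDimensional_of_le h

instance finiteDimensional_sphericalHarmonics (d : ℕ) :
    FiniteDimensional ℂ (sphericalHarmonics d) := by
  unfold sphericalHarmonics
  infer_instance

/-- For `q ≥ 1`, the spectral projector `π_q`: the orthogonal projection of `L²(S³)` onto the
space of spherical harmonics of degree `q - 1`, the eigenspace of `-Δ + 1` for the
eigenvalue `q²`. -/
def spectralProj (q : ℕ) : L2 →L[ℂ] L2 := (sphericalHarmonics (q - 1)).starProjection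

end SphereCluster

end

/-!
The surface measure is rotation invariant, so the derivative of a function along an infinitesimal
rotation has mean zero on the sphere; summing over all coordinate planes gives Green's identity for
the Laplace–Beltrami operator. Testing the eigenvalue equation of a spherical harmonic `u` with
`g(ρ) ⟨∇ρ, ∇u⟩`, where `ρ x = ⟪P, x⟫` and `g` is increasing, yields a Morawetz inequality: a
weighted integral of the energy density `|∇u|² + μ u²` is at most a multiple of `∫ u² Δ(ρ g(ρ))`.
For `g = r / √(r² + 1 - ρ)`, a regularization of `r / |x - P|`, the weight is at least `g³ - 2r`
and `Δ(ρ g(ρ)) = O(r)`. As the total energy is `2 μ ∫ u²`, dividing by `μ` bounds the mass of `u`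
in the ball of radius `r` by `O(r) ∫ u²`, which is the square of the claimed operator bound. In
degree `0`, where `μ = 0`, the measure of the ball is bounded by the mass of the harmonic `ρ` of
degree `1`.
-/

noncomputable section

namespace SphereCluster

open Metric Set InnerProductSpace
open scoped RealInnerProductSpace Pointwise Gradient Laplacian

theorem continuous_comp_coe_sphere {E G : Type*} [SeminormedAddCommGroup E] [TopologicalSpace G]
    {F : E → G} (hF : ∀ x ∈ sphere (0 : E) 1, ContinuousAt F x) :
    Continuous fun x : sphere (0 : E) 1 => F x :=
  continuous_iff_continuousAt.2 fun x => (hF x x.2).comp continuous_subtype_val.continuousAt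

section Invariance

variable {E : Type*} [NormedAddCommGroup E] [InnerProductSpace ℝ E]

/-- The action of a linear isometry equivalence on the unit sphere. -/
def sphereMap (R : E ≃ₗᵢ[ℝ] E) (x : sphere (0 : E) 1) : sphere (0 : E) 1 :=
  ⟨R x, by simp⟩

theorem continuous_sphereMap (R : E ≃ₗᵢ[ℝ] E) : Continuous (sphereMap R) := by
  unfold sphereMap
  fun_prop

theorem smul_image_preimage_sphereMap (R : E ≃ₗᵢ[ℝ] E) (I : Set ℝ) (s : Set (sphere (0 : E) 1)) :
    I • ((↑) '' (sphereMap R ⁻¹' s) : Set E) = R ⁻¹' (I • ((↑) '' s)) := by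
  ext y
  simp only [mem_smul, mem_image, mem_preimage]
  constructor
  · rintro ⟨c, hc, _, ⟨x, hx, rfl⟩, rfl⟩
    exact ⟨c, hc, _, ⟨_, hx, rfl⟩, by simp [sphereMap]⟩
  · rintro ⟨c, hc, _, ⟨x, hx, rfl⟩, hy⟩
    have hRx : sphereMap R (sphereMap R.symm x) = x := by ext1; simp [sphereMap]
    refine ⟨c, hc, _, ⟨sphereMap R.symm x, hRx.symm ▸ hx, rfl⟩, R.injective ?_⟩
    rw [← hy]
    simp [sphereMap]

variable [FiniteDimensional ℝ E]

theorem exists_linearIsometryEquiv_exp {A : E →L[ℝ] E} (hA : ∀ x, ⟪x, A x⟫ = 0) (t : ℝ) :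
    ∃ R : E ≃ₗᵢ[ℝ] E, ∀ x, R x = NormedSpace.exp (t • A) x := by
  have : CompleteSpace E := FiniteDimensional.complete ℝ E
  have hderiv (x : E) (s : ℝ) :
      HasDerivAt (fun s : ℝ => ‖NormedSpace.exp (s • A) x‖ ^ 2) 0 s := by
    have h := ((hasDerivAt_exp_smul_const' A s).clm_apply (hasDerivAt_const s x)).norm_sq
    simpa [hA] using h
  have hnorm (x : E) : ‖NormedSpace.exp (t • A) x‖ = ‖x‖ := by
    have h := is_const_of_deriv_eq_zero (fun s => (hderiv x s).differentiableAt)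
      (fun s => (hderiv x s).deriv) t 0
    simpa using h
  exact ⟨LinearIsometry.toLinearIsometryEquiv ⟨(NormedSpace.exp (t • A)).toLinearMap, hnorm⟩ rfl,
    fun x => rfl⟩

variable [MeasurableSpace E] [BorelSpace E]

theorem measurePreserving_sphereMap (R : E ≃ₗᵢ[ℝ] E) :
    MeasurePreserving (sphereMap R) (volume : Measure E).toSphere
      (volume : Measure E).toSphere := by
  have hR := (continuous_sphereMap R).measurable
  refine ⟨hR, Measure.ext fun s hs => ?_⟩
  rw [Measure.map_apply hR hs, Measure.toSphere_apply' _ hs, Measure.toSphere_apply' _ (hR hs),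
    smul_image_preimage_sphereMap]
  congr 1
  exact R.measurePreserving.measure_preimage_equiv (f := R.toMeasurableEquiv) _

theorem integral_sphere_comp_isometry (R : E ≃ₗᵢ[ℝ] E) (F : E → ℝ) :
    ∫ x : sphere (0 : E) 1, F (R x) ∂(volume : Measure E).toSphere =
      ∫ x : sphere (0 : E) 1, F x ∂(volume : Measure E).toSphere := by
  have he : MeasurableEmbedding (sphereMap R) :=
    ((continuous_sphereMap R).isClosedEmbedding fun x y h =>
      Subtype.ext (R.injective (Subtype.ext_iff.1 h))).measurableEmbedding
  exact (measurePreserving_sphereMap R).integral_comp he fun x : sphere (0 : E) 1 => F x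

theorem integrable_toSphere_of_continuous {F : sphere (0 : E) 1 → ℝ} (hF : Continuous F) :
    Integrable F (volume : Measure E).toSphere :=
  hF.integrable_of_hasCompactSupport (.of_compactSpace _)

theorem integral_fderiv_skew {A : E →L[ℝ] E} (hA : ∀ x, ⟪x, A x⟫ = 0) {F : E → ℝ}
    (hF : ∀ x ∈ sphere (0 : E) 1, ContDiffAt ℝ 1 F x) :
    ∫ x : sphere (0 : E) 1, fderiv ℝ F x (A x) ∂(volume : Measure E).toSphere = 0 := by
  have : CompleteSpace E := FiniteDimensional.complete ℝ E
  choose R hR using exists_linearIsometryEquiv_exp hA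
  have hR0 (x : E) : R 0 x = x := by simp [hR]
  have hRsphere (t : ℝ) (x : sphere (0 : E) 1) : R t x ∈ sphere (0 : E) 1 := (sphereMap (R t) x).2
  have hderiv (x : sphere (0 : E) 1) (t : ℝ) :
      HasDerivAt (fun t => F (R t x)) (fderiv ℝ F (R t x) (A (R t x))) t := by
    have hflow : HasDerivAt (fun t => R t x) (A (R t x)) t := by
      simpa [hR] using (hasDerivAt_exp_smul_const' A t).clm_apply (hasDerivAt_const t (x : E))
    exact ((hF _ (hRsphere t x)).differentiableAt one_ne_zero).hasFDerivAt.comp_hasDerivAt t hflow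
  have hFcont := continuous_comp_coe_sphere fun x hx => (hF x hx).continuousAt
  have hF' : ∀ x ∈ sphere (0 : E) 1, ContinuousAt (fun y => fderiv ℝ F y (A y)) x := fun x hx =>
    ((hF x hx).fderiv_right (m := 0) le_rfl).continuousAt.clm_apply A.continuous.continuousAt
  obtain ⟨M, hM⟩ := (isCompact_range (continuous_comp_coe_sphere hF').norm).bddAbove
  have hintegral := (hasDerivAt_integral_of_dominated_loc_of_deriv_le
    (μ := (volume : Measure E).toSphere) (x₀ := (0 : ℝ)) (bound := fun _ => M)
    (F := fun t (x : sphere (0 : E) 1) => F (R t x))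
    (F' := fun t x => fderiv ℝ F (R t x) (A (R t x))) Filter.univ_mem
    (.of_forall fun t => (hFcont.comp (continuous_sphereMap (R t))).aestronglyMeasurable)
    (by simpa only [hR0] using integrable_toSphere_of_continuous hFcont)
    (by simpa only [hR0] using (continuous_comp_coe_sphere hF').aestronglyMeasurable)
    (.of_forall fun x t _ => hM ⟨sphereMap (R t) x, rfl⟩)
    (integrable_const _)
    (.of_forall fun x t _ => hderiv x t)).2
  simp only [integral_sphere_comp_isometry (R _) F, hR0] at hintegral
  exact hintegral.unique (hasDerivAt_const _ _)

end Invariance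

theorem fderiv_inner_left {E : Type*} [NormedAddCommGroup E] [InnerProductSpace ℝ E]
    (P : E) : (fderiv ℝ fun y => ⟪P, y⟫) = fun _ => innerSL ℝ P :=
  funext fun _ => (innerSL ℝ P).fderiv

section CarreDuChamp

variable {E : Type*} [NormedAddCommGroup E] [InnerProductSpace ℝ E] [CompleteSpace E]

/-- The gradient along the unit sphere: for `‖x‖ = 1`, the component of `∇ u x` tangent to the
sphere at `x`. -/
def sphericalGradient (u : E → ℝ) (x : E) : E := ∇ u x - (fderiv ℝ u x x) • x

/-- The carré du champ `Γ(u, v)` of the unit sphere: the derivative of `u` along the spherical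
gradient of `v`. It is defined for functions on the ambient space, so that it can be
differentiated again. -/
def carreDuChamp (u v : E → ℝ) (x : E) : ℝ := fderiv ℝ u x (sphericalGradient v x)

variable {a u v : E → ℝ} {P x : E}

theorem carreDuChamp_eq_inner_gradient (u v : E → ℝ) (x : E) :
    carreDuChamp u v x = ⟪∇ u x, ∇ v x⟫ - fderiv ℝ u x x * fderiv ℝ v x x := by
  rw [carreDuChamp, sphericalGradient, map_sub, map_smul, smul_eq_mul, inner_gradient_left,
    mul_comm]

theorem sphericalGradient_inner_left (P x : E) :
    sphericalGradient (fun y => ⟪P, y⟫) x = P - ⟪P, x⟫ • x := by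
  have h : HasGradientAt (fun y => ⟪P, y⟫) P x := (innerSL ℝ P).hasFDerivAt
  simp [sphericalGradient, h.gradient, fderiv_inner_left]

theorem carreDuChamp_inner_left_self (hP : ‖P‖ = 1) (x : E) :
    carreDuChamp (fun y => ⟪P, y⟫) (fun y => ⟪P, y⟫) x = 1 - ⟪P, x⟫ ^ 2 := by
  simp [carreDuChamp, fderiv_inner_left, sphericalGradient_inner_left, inner_sub_right,
    inner_smul_right, hP, sq]

theorem carreDuChamp_comm (u v : E → ℝ) (x : E) : carreDuChamp u v x = carreDuChamp v u x := by
  simp only [carreDuChamp_eq_inner_gradient, real_inner_comm, mul_comm]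

theorem carreDuChamp_eq_inner (u v : E → ℝ) (hx : ‖x‖ = 1) :
    carreDuChamp u v x = ⟪sphericalGradient u x, sphericalGradient v x⟫ := by
  have hxx : ⟪x, x⟫ = 1 := by rw [real_inner_self_eq_norm_sq, hx, one_pow]
  simp only [carreDuChamp_eq_inner_gradient, sphericalGradient, inner_sub_left, inner_sub_right,
    inner_smul_left, inner_smul_right, inner_gradient_left, real_inner_comm _ x, hxx,
    conj_trivial]
  ring

theorem carreDuChamp_self_nonneg (u : E → ℝ) (hx : ‖x‖ = 1) : 0 ≤ carreDuChamp u u x := by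
  rw [carreDuChamp_eq_inner u u hx]
  exact real_inner_self_nonneg

theorem carreDuChamp_inner_left_sq_le (u : E → ℝ) (hP : ‖P‖ = 1) (hx : ‖x‖ = 1) :
    carreDuChamp (fun y => ⟪P, y⟫) u x ^ 2 ≤ (1 - ⟪P, x⟫ ^ 2) * carreDuChamp u u x := by
  rw [← carreDuChamp_inner_left_self hP, carreDuChamp_eq_inner _ _ hx, carreDuChamp_eq_inner _ _ hx,
    carreDuChamp_eq_inner _ _ hx, sq]
  exact real_inner_mul_inner_self_le _ _

theorem carreDuChamp_mul (hu : DifferentiableAt ℝ u x) (hv : DifferentiableAt ℝ v x) (a : E → ℝ) :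
    carreDuChamp (fun y => u y * v y) a x =
      u x * carreDuChamp v a x + v x * carreDuChamp u a x := by
  simp [carreDuChamp, fderiv_fun_mul hu hv]

theorem carreDuChamp_sub (hu : DifferentiableAt ℝ u x) (hv : DifferentiableAt ℝ v x) (a : E → ℝ) :
    carreDuChamp (fun y => u y - v y) a x = carreDuChamp u a x - carreDuChamp v a x := by
  simp [carreDuChamp, fderiv_fun_sub hu hv]

theorem carreDuChamp_comp {g : ℝ → ℝ} (hg : DifferentiableAt ℝ g (u x))
    (hu : DifferentiableAt ℝ u x) (a : E → ℝ) :
    carreDuChamp (fun y => g (u y)) a x = deriv g (u x) * carreDuChamp u a x := by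
  have h := hg.hasDerivAt.comp_hasFDerivAt x hu.hasFDerivAt
  simp only [carreDuChamp]
  rw [show fderiv ℝ (fun y => g (u y)) x = _ from h.fderiv]
  rfl

theorem hasFDerivAt_gradient (hu : ContDiffAt ℝ 2 u x) :
    HasFDerivAt (∇ u)
      ((toDual ℝ E).symm.toContinuousLinearEquiv.toContinuousLinearMap ∘L fderiv ℝ (fderiv ℝ u) x)
      x :=
  (toDual ℝ E).symm.toContinuousLinearEquiv.hasFDerivAt.comp x
    ((hu.fderiv_right (m := 1) le_rfl).differentiableAt one_ne_zero).hasFDerivAt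

theorem continuousAt_carreDuChamp (hv : ContDiffAt ℝ 1 v x) (hu : ContDiffAt ℝ 1 u x) :
    ContinuousAt (carreDuChamp v u) x := by
  have hv' : ContinuousAt (fderiv ℝ v) x := (hv.fderiv_right (m := 0) le_rfl).continuousAt
  have hu' : ContinuousAt (fderiv ℝ u) x := (hu.fderiv_right (m := 0) le_rfl).continuousAt
  have hgrad : ContinuousAt (∇ u) x :=
    (toDual ℝ E).symm.continuous.continuousAt.comp hu'
  unfold carreDuChamp sphericalGradient
  fun_prop

theorem contDiffAt_carreDuChamp (hu : ContDiffAt ℝ 2 u x) (hv : ContDiffAt ℝ 2 v x) :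
    ContDiffAt ℝ 1 (carreDuChamp u v) x := by
  have hu' := hu.fderiv_right (m := 1) le_rfl
  have hv' := hv.fderiv_right (m := 1) le_rfl
  have hgrad : ContDiffAt ℝ 1 (∇ v) x :=
    (toDual ℝ E).symm.toContinuousLinearEquiv.contDiff.contDiffAt.comp x hv'
  exact hu'.clm_apply (hgrad.sub ((hv'.clm_apply contDiffAt_id).smul contDiffAt_id))

theorem fderiv_carreDuChamp (hu : ContDiffAt ℝ 2 u x) (hv : ContDiffAt ℝ 2 v x) (w : E) :
    fderiv ℝ (carreDuChamp u v) x w =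
      fderiv ℝ (fderiv ℝ u) x w (sphericalGradient v x) +
        fderiv ℝ (fderiv ℝ v) x w (sphericalGradient u x) -
        fderiv ℝ u x x * fderiv ℝ v x w - fderiv ℝ v x x * fderiv ℝ u x w := by
  have hu' := ((hu.fderiv_right (m := 1) le_rfl).differentiableAt one_ne_zero).hasFDerivAt
  have hv' := ((hv.fderiv_right (m := 1) le_rfl).differentiableAt one_ne_zero).hasFDerivAt
  have hradial := (hu'.clm_apply (hasFDerivAt_id x)).mul (hv'.clm_apply (hasFDerivAt_id x))
  have h := ((hasFDerivAt_gradient hu).inner ℝ (hasFDerivAt_gradient hv)).sub hradial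
  have hfun : carreDuChamp u v = fun y => ⟪∇ u y, ∇ v y⟫ - fderiv ℝ u y y * fderiv ℝ v y y :=
    funext (carreDuChamp_eq_inner_gradient u v)
  have hdual (f : E → ℝ) (L : StrongDual ℝ E) : fderiv ℝ f x ((toDual ℝ E).symm L) = L (∇ f x) := by
    rw [← inner_gradient_left, real_inner_comm, toDual_symm_apply]
  rw [hfun]
  refine (congrArg (· w) h.fderiv).trans ?_
  simp [sphericalGradient, inner_gradient_left, hdual]
  ring

theorem bochner_commutator (hu : ContDiffAt ℝ 2 u x) (ha : ContDiffAt ℝ 2 a x) :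
    2 * carreDuChamp (carreDuChamp a u) u x - carreDuChamp (carreDuChamp u u) a x =
      2 * (fderiv ℝ (fderiv ℝ a) x (sphericalGradient u x) (sphericalGradient u x) -
        fderiv ℝ a x x * carreDuChamp u u x) := by
  have hsymm := hu.isSymmSndFDerivAt (by simp) (sphericalGradient a x) (sphericalGradient u x)
  have hau := carreDuChamp_comm a u x
  rw [carreDuChamp, carreDuChamp, fderiv_carreDuChamp ha hu, fderiv_carreDuChamp hu hu, hsymm]
  simp only [carreDuChamp] at hau ⊢
  rw [hau]
  ring

end CarreDuChamp

section RotationGenerator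

variable {E ι : Type*} [NormedAddCommGroup E] [InnerProductSpace ℝ E] [Fintype ι]

/-- The infinitesimal rotation in the plane spanned by `a` and `b`. Taken over the planes of an
orthonormal basis, these vector fields express the Laplace–Beltrami operator of the unit sphere as a
sum of squares. -/
def rotationGenerator (a b : E) : E →L[ℝ] E :=
  (innerSL ℝ a).smulRight b - (innerSL ℝ b).smulRight a

theorem rotationGenerator_apply (a b x : E) :
    rotationGenerator a b x = ⟪a, x⟫ • b - ⟪b, x⟫ • a := rfl

theorem inner_rotationGenerator_self (a b x : E) : ⟪x, rotationGenerator a b x⟫ = 0 := by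
  simp only [rotationGenerator_apply, inner_sub_right, inner_smul_right, real_inner_comm x]
  ring

theorem sum_bilin_rotationGenerator (e : OrthonormalBasis ι ℝ E) (B : E →L[ℝ] E →L[ℝ] ℝ) (x : E) :
    ∑ i, ∑ j, B (rotationGenerator (e i) (e j) x) (rotationGenerator (e i) (e j) x) =
      2 * (‖x‖ ^ 2 * ∑ i, B (e i) (e i) - B x x) := by
  have hBxx : B x x = ∑ i, ∑ j, ⟪e i, x⟫ * ⟪e j, x⟫ * B (e i) (e j) := by
    rw [Finset.sum_comm]
    conv_lhs => rw [← e.sum_repr' x]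
    simp [Finset.mul_sum, mul_assoc, mul_left_comm]
  have hterm (i j : ι) :
      B (rotationGenerator (e i) (e j) x) (rotationGenerator (e i) (e j) x) =
        ⟪e i, x⟫ ^ 2 * B (e j) (e j) + ⟪e j, x⟫ ^ 2 * B (e i) (e i) -
          (⟪e i, x⟫ * ⟪e j, x⟫ * B (e i) (e j) + ⟪e j, x⟫ * ⟪e i, x⟫ * B (e j) (e i)) := by
    simp [rotationGenerator_apply]
    ring
  have hdiag : ∑ i, ∑ j, ⟪e i, x⟫ ^ 2 * B (e j) (e j) = ‖x‖ ^ 2 * ∑ i, B (e i) (e i) := by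
    rw [← e.sum_sq_inner_right, Finset.sum_mul_sum]
  simp only [hterm, Finset.sum_sub_distrib, Finset.sum_add_distrib]
  rw [Finset.sum_comm (f := fun i j => ⟪e j, x⟫ ^ 2 * B (e i) (e i)),
    Finset.sum_comm (f := fun i j => ⟪e j, x⟫ * ⟪e i, x⟫ * B (e j) (e i)), hdiag, ← hBxx]
  ring

theorem sum_rotationGenerator_rotationGenerator (e : OrthonormalBasis ι ℝ E) (x : E) :
    ∑ i, ∑ j, rotationGenerator (e i) (e j) (rotationGenerator (e i) (e j) x) =
      (2 * (1 - Fintype.card ι : ℝ)) • x := by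
  classical
  have hterm (i j : ι) : rotationGenerator (e i) (e j) (rotationGenerator (e i) (e j) x) =
      (if i = j then ⟪e j, x⟫ • e j else 0) + (if i = j then ⟪e i, x⟫ • e i else 0) -
        (⟪e j, x⟫ • e j + ⟪e i, x⟫ • e i) := by
    simp only [rotationGenerator_apply, inner_sub_right, inner_smul_right,
      orthonormal_iff_ite.1 e.orthonormal]
    by_cases hij : i = j
    · subst hij
      simp
    · simp [hij, Ne.symm hij]
      module
  simp only [hterm, Finset.sum_sub_distrib, Finset.sum_add_distrib, Finset.sum_ite_eq,
    Finset.mem_univ, if_true, Finset.sum_const, ← Finset.smul_sum, e.sum_repr', Finset.card_univ,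
    ← Nat.cast_smul_eq_nsmul ℝ]
  module

end RotationGenerator

section IntegrationByParts

variable {E : Type*} [NormedAddCommGroup E] [InnerProductSpace ℝ E] [FiniteDimensional ℝ E]

local instance completeSpace_of_finiteDimensional : CompleteSpace E :=
  FiniteDimensional.complete ℝ E

/-- The Laplace–Beltrami operator of the unit sphere, for functions on the ambient space: for
`‖x‖ = 1` it agrees with the Laplacian of the restriction of `u` to the sphere. -/
def sphericalLaplacian (u : E → ℝ) (x : E) : ℝ :=
  Δ u x - fderiv ℝ (fderiv ℝ u) x x x - (Module.finrank ℝ E - 1) * fderiv ℝ u x x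

theorem laplacian_eq_sum_fderiv {ι : Type*} [Fintype ι] (e : OrthonormalBasis ι ℝ E) (u : E → ℝ)
    (x : E) : Δ u x = ∑ i, fderiv ℝ (fderiv ℝ u) x (e i) (e i) := by
  simp [laplacian_eq_iteratedFDeriv_orthonormalBasis u e, iteratedFDeriv_two_apply]

theorem sum_fderiv_rotationGenerator {ι : Type*} [Fintype ι] (e : OrthonormalBasis ι ℝ E)
    {h u : E → ℝ} {x : E} (hx : ‖x‖ = 1) (hh : DifferentiableAt ℝ h x)
    (hu : ContDiffAt ℝ 2 u x) :
    ∑ i, ∑ j, fderiv ℝ (fun y => h y * fderiv ℝ u y (rotationGenerator (e i) (e j) y)) x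
        (rotationGenerator (e i) (e j) x) =
      2 * (carreDuChamp h u x + h x * sphericalLaplacian u x) := by
  have hu' := ((hu.fderiv_right (m := 1) le_rfl).differentiableAt one_ne_zero).hasFDerivAt
  have hderiv (A : E →L[ℝ] E) : fderiv ℝ (fun y => h y * fderiv ℝ u y (A y)) x (A x) =
      ((fderiv ℝ h x).smulRight (fderiv ℝ u x) + h x • fderiv ℝ (fderiv ℝ u) x) (A x) (A x) +
        h x * fderiv ℝ u x (A (A x)) := by
    refine (congrArg (· (A x)) (hh.hasFDerivAt.mul (hu'.clm_apply A.hasFDerivAt)).fderiv).trans ?_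
    simp
    ring
  have hcasimir : ∑ i, ∑ j, fderiv ℝ u x
      (rotationGenerator (e i) (e j) (rotationGenerator (e i) (e j) x)) =
        2 * (1 - Module.finrank ℝ E) * fderiv ℝ u x x := by
    simp only [← map_sum, sum_rotationGenerator_rotationGenerator, map_smul, smul_eq_mul,
      Module.finrank_eq_card_basis e.toBasis]
  have hgrad : ∑ i, fderiv ℝ h x (e i) * fderiv ℝ u x (e i) = ⟪∇ h x, ∇ u x⟫ := by
    rw [← e.sum_inner_mul_inner]
    simp only [← inner_gradient_left, real_inner_comm (e _) (∇ u x)]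
  simp only [hderiv, Finset.sum_add_distrib, sum_bilin_rotationGenerator, ← Finset.mul_sum,
    hcasimir, hx]
  simp [Finset.sum_add_distrib, hgrad, ← Finset.mul_sum, ← laplacian_eq_sum_fderiv,
    carreDuChamp_eq_inner_gradient, sphericalLaplacian]
  ring

variable [MeasurableSpace E] [BorelSpace E]

theorem integral_carreDuChamp_add_mul_sphericalLaplacian {h u : E → ℝ}
    (hh : ∀ x ∈ sphere (0 : E) 1, ContDiffAt ℝ 1 h x)
    (hu : ∀ x ∈ sphere (0 : E) 1, ContDiffAt ℝ 2 u x) :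
    ∫ x : sphere (0 : E) 1, (carreDuChamp h u x + h x * sphericalLaplacian u x)
      ∂(volume : Measure E).toSphere = 0 := by
  set e := stdOrthonormalBasis ℝ E
  have hF (A : E →L[ℝ] E) : ∀ x ∈ sphere (0 : E) 1,
      ContDiffAt ℝ 1 (fun y => h y * fderiv ℝ u y (A y)) x := fun x hx =>
    (hh x hx).mul (((hu x hx).fderiv_right (m := 1) le_rfl).clm_apply A.contDiff.contDiffAt)
  have hF' (A : E →L[ℝ] E) : Integrable (fun x : sphere (0 : E) 1 =>
      fderiv ℝ (fun y => h y * fderiv ℝ u y (A y)) x (A x)) (volume : Measure E).toSphere :=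
    integrable_toSphere_of_continuous (continuous_comp_coe_sphere fun x hx =>
      ((hF A x hx).fderiv_right (m := 0) le_rfl).continuousAt.clm_apply A.continuous.continuousAt)
  have hsum (x : sphere (0 : E) 1) :
      carreDuChamp h u x + h x * sphericalLaplacian u x = (1 / 2) * ∑ i, ∑ j,
        fderiv ℝ (fun y => h y * fderiv ℝ u y (rotationGenerator (e i) (e j) y)) x
          (rotationGenerator (e i) (e j) x) := by
    rw [sum_fderiv_rotationGenerator e (by simp) ((hh x x.2).differentiableAt one_ne_zero)
      (hu x x.2)]
    ring
  simp only [hsum]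
  rw [integral_const_mul, integral_finsetSum _ fun i _ => integrable_finsetSum _ fun j _ => hF' _]
  simp only [integral_finsetSum _ fun j _ => hF' (rotationGenerator (e _) (e j)),
    integral_fderiv_skew (inner_rotationGenerator_self _ _) (hF _), Finset.sum_const_zero, mul_zero]

end IntegrationByParts

attribute [local instance] completeSpace_of_finiteDimensional

variable {E : Type*} [NormedAddCommGroup E] [InnerProductSpace ℝ E] [FiniteDimensional ℝ E]

section Eigenfunction

/-- `u` restricts to an eigenfunction of minus the Laplace–Beltrami operator of the unit sphere,
with eigenvalue `μ`. -/
structure IsSphericalEigenfunction (u : E → ℝ) (μ : ℝ) : Prop where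
  contDiffAt : ∀ x ∈ sphere (0 : E) 1, ContDiffAt ℝ 2 u x
  sphericalLaplacian_eq : ∀ x ∈ sphere (0 : E) 1, sphericalLaplacian u x = -μ * u x

variable {u : E → ℝ} {φ : ℝ → ℝ} {P x : E}

theorem isSphericalEigenfunction_inner_left (P : E) :
    IsSphericalEigenfunction (fun y => ⟪P, y⟫) (Module.finrank ℝ E - 1) where
  contDiffAt x _ := (innerSL ℝ P).contDiff.contDiffAt
  sphericalLaplacian_eq x _ := by
    simp [sphericalLaplacian, laplacian_eq_sum_fderiv (stdOrthonormalBasis ℝ E),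
      fderiv_inner_left]
    ring

theorem sphericalLaplacian_comp_inner_left (hP : ‖P‖ = 1) (hφ : ContDiffAt ℝ 2 φ ⟪P, x⟫) :
    sphericalLaplacian (fun y => φ ⟪P, y⟫) x =
      (1 - ⟪P, x⟫ ^ 2) * deriv (deriv φ) ⟪P, x⟫ -
        (Module.finrank ℝ E - 1) * ⟪P, x⟫ * deriv φ ⟪P, x⟫ := by
  have hφ' : ∀ᶠ s in nhds ⟪P, x⟫, HasDerivAt φ (deriv φ s) s :=
    (hφ.eventually (by simp)).mono fun s hs => (hs.differentiableAt two_ne_zero).hasDerivAt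
  have hfderiv : fderiv ℝ (fun y => φ ⟪P, y⟫) =ᶠ[nhds x] fun y => deriv φ ⟪P, y⟫ • innerSL ℝ P :=
    ((innerSL ℝ P).continuous.continuousAt.eventually hφ').mono fun y hy =>
      (hy.comp_hasFDerivAt y (innerSL ℝ P).hasFDerivAt).fderiv
  have hφ'' : HasDerivAt (deriv φ) (deriv (deriv φ) ⟪P, x⟫) ⟪P, x⟫ :=
    ((hφ.derivWithin (m := 1) le_rfl).differentiableAt one_ne_zero).hasDerivAt
  have hfderiv2 : fderiv ℝ (fderiv ℝ fun y => φ ⟪P, y⟫) x =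
      (deriv (deriv φ) ⟪P, x⟫ • innerSL ℝ P).smulRight (innerSL ℝ P) :=
    hfderiv.fderiv_eq.trans
      ((hφ''.comp_hasFDerivAt x (innerSL ℝ P).hasFDerivAt).smul_const (innerSL ℝ P)).fderiv
  have hsum : ∑ i, ⟪P, stdOrthonormalBasis ℝ E i⟫ ^ 2 = 1 := by
    simp [OrthonormalBasis.sum_sq_inner_left, hP]
  simp [sphericalLaplacian, laplacian_eq_sum_fderiv (stdOrthonormalBasis ℝ E), hfderiv2,
    hfderiv.self_of_nhds, mul_assoc, ← sq, ← Finset.mul_sum, hsum]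
  ring

theorem continuousAt_sphericalLaplacian (hu : ContDiffAt ℝ 2 u x) :
    ContinuousAt (sphericalLaplacian u) x := by
  have hu' : ContinuousAt (fderiv ℝ u) x := (hu.fderiv_right (m := 1) le_rfl).continuousAt
  have hu'' : ContinuousAt (fderiv ℝ (fderiv ℝ u)) x :=
    ((hu.fderiv_right (m := 1) le_rfl).fderiv_right (m := 0) le_rfl).continuousAt
  unfold sphericalLaplacian
  simp only [laplacian_eq_sum_fderiv (stdOrthonormalBasis ℝ E)]
  fun_prop

end Eigenfunction

section VirialIdentity

variable {f u : E → ℝ} {g : ℝ → ℝ} {μ : ℝ} {P x : E}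

theorem carreDuChamp_mul_energy_inner_left (hu : ContDiffAt ℝ 2 u x) (hP : ‖P‖ = 1)
    (hg : DifferentiableAt ℝ g ⟪P, x⟫) (μ : ℝ) :
    carreDuChamp (fun y => g ⟪P, y⟫ * (carreDuChamp u u y - μ * u y ^ 2)) (fun y => ⟪P, y⟫) x =
      deriv g ⟪P, x⟫ * ((1 - ⟪P, x⟫ ^ 2) * (carreDuChamp u u x - μ * u x ^ 2)) +
        2 * g ⟪P, x⟫ * (carreDuChamp (carreDuChamp (fun y => ⟪P, y⟫) u) u x +
          ⟪P, x⟫ * carreDuChamp u u x - μ * (u x * carreDuChamp (fun y => ⟪P, y⟫) u x)) := by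
  have hρ : ContDiffAt ℝ 2 (fun y : E => ⟪P, y⟫) x := (innerSL ℝ P).contDiff.contDiffAt
  have hρ' := hρ.differentiableAt two_ne_zero
  have hu' := hu.differentiableAt two_ne_zero
  have hΓ := (contDiffAt_carreDuChamp hu hu).differentiableAt one_ne_zero
  have hμ : DifferentiableAt ℝ (fun s : ℝ => μ * s ^ 2) (u x) := by fun_prop
  have hderiv : deriv (fun s : ℝ => μ * s ^ 2) (u x) = 2 * μ * u x := by
    simp
    ring
  have hbochner : 2 * carreDuChamp (carreDuChamp (fun y => ⟪P, y⟫) u) u x -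
      carreDuChamp (carreDuChamp u u) (fun y => ⟪P, y⟫) x =
        -(2 * (⟪P, x⟫ * carreDuChamp u u x)) := by
    simpa [fderiv_inner_left] using bochner_commutator hu hρ
  rw [carreDuChamp_mul (u := fun y => g ⟪P, y⟫) (v := fun y => carreDuChamp u u y - μ * u y ^ 2)
      (hg.comp x hρ') (hΓ.sub (hμ.comp x hu')),
    carreDuChamp_sub hΓ (v := fun y => μ * u y ^ 2) (hμ.comp x hu'),
    carreDuChamp_comp hμ hu', hderiv, carreDuChamp_comm u, carreDuChamp_comp hg hρ',
    carreDuChamp_inner_left_self hP]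
  linear_combination (-g ⟪P, x⟫) * hbochner

variable [MeasurableSpace E] [BorelSpace E]

theorem integrable_carreDuChamp_add_mul_sphericalLaplacian {h u : E → ℝ}
    (hh : ∀ x ∈ sphere (0 : E) 1, ContDiffAt ℝ 1 h x)
    (hu : ∀ x ∈ sphere (0 : E) 1, ContDiffAt ℝ 2 u x) :
    Integrable (fun x : sphere (0 : E) 1 => carreDuChamp h u x + h x * sphericalLaplacian u x)
      (volume : Measure E).toSphere :=
  integrable_toSphere_of_continuous (continuous_comp_coe_sphere fun x hx =>
    (continuousAt_carreDuChamp (hh x hx) ((hu x hx).of_le one_le_two)).add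
      ((hh x hx).continuousAt.mul (continuousAt_sphericalLaplacian (hu x hx))))

theorem integral_linear_combination_carreDuChamp_add_mul_sphericalLaplacian {h u k v : E → ℝ}
    (hh : ∀ x ∈ sphere (0 : E) 1, ContDiffAt ℝ 1 h x)
    (hu : ∀ x ∈ sphere (0 : E) 1, ContDiffAt ℝ 2 u x)
    (hk : ∀ x ∈ sphere (0 : E) 1, ContDiffAt ℝ 1 k x)
    (hv : ∀ x ∈ sphere (0 : E) 1, ContDiffAt ℝ 2 v x) (c : ℝ) :
    ∫ x : sphere (0 : E) 1, (c * (carreDuChamp h u x + h x * sphericalLaplacian u x) +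
      (carreDuChamp k v x + k x * sphericalLaplacian v x)) ∂(volume : Measure E).toSphere = 0 := by
  rw [integral_add ((integrable_carreDuChamp_add_mul_sphericalLaplacian hh hu).const_mul c)
    (integrable_carreDuChamp_add_mul_sphericalLaplacian hk hv), integral_const_mul,
    integral_carreDuChamp_add_mul_sphericalLaplacian hh hu,
    integral_carreDuChamp_add_mul_sphericalLaplacian hk hv, mul_zero, zero_add]

theorem integral_equipartition (hu : IsSphericalEigenfunction u μ)
    (hf : ∀ x ∈ sphere (0 : E) 1, ContDiffAt ℝ 2 f x) :
    ∫ x : sphere (0 : E) 1, (u x ^ 2 * sphericalLaplacian f x -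
      2 * (f x * (carreDuChamp u u x - μ * u x ^ 2))) ∂(volume : Measure E).toSphere = 0 := by
  have hfu : ∀ x ∈ sphere (0 : E) 1, ContDiffAt ℝ 1 (fun y => f y * u y) x := fun x hx =>
    ((hf x hx).mul (hu.contDiffAt x hx)).of_le one_le_two
  have huu : ∀ x ∈ sphere (0 : E) 1, ContDiffAt ℝ 1 (fun y => u y * u y) x := fun x hx =>
    ((hu.contDiffAt x hx).mul (hu.contDiffAt x hx)).of_le one_le_two
  rw [← integral_linear_combination_carreDuChamp_add_mul_sphericalLaplacian hfu hu.contDiffAt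
    huu hf (-2)]
  congr 1
  ext x
  have hux := (hu.contDiffAt x x.2).differentiableAt two_ne_zero
  have hfx := (hf x x.2).differentiableAt two_ne_zero
  rw [carreDuChamp_mul hfx hux, carreDuChamp_mul hux hux, hu.sphericalLaplacian_eq x x.2,
    carreDuChamp_comm f u]
  ring

theorem integral_pohozaev (hu : IsSphericalEigenfunction u μ) (hP : ‖P‖ = 1)
    (hg : ∀ s ∈ Icc (-1 : ℝ) 1, ContDiffAt ℝ 1 g s) :
    ∫ x : sphere (0 : E) 1, (deriv g ⟪P, x⟫ * ((1 - ⟪P, x⟫ ^ 2) *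
      (carreDuChamp u u x - μ * u x ^ 2) - 2 * carreDuChamp (fun y => ⟪P, y⟫) u x ^ 2) +
        ⟪P, x⟫ * g ⟪P, x⟫ * ((3 - Module.finrank ℝ E) * carreDuChamp u u x +
          (Module.finrank ℝ E - 1) * (μ * u x ^ 2))) ∂(volume : Measure E).toSphere = 0 := by
  have hρ (x : E) : ContDiffAt ℝ 2 (fun y => ⟪P, y⟫) x := (innerSL ℝ P).contDiff.contDiffAt
  have hgx : ∀ x ∈ sphere (0 : E) 1, ContDiffAt ℝ 1 g ⟪P, x⟫ := fun x hx =>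
    hg _ (real_inner_mem_Icc_of_norm_eq_one hP (by simpa using hx))
  have hgρ : ∀ x ∈ sphere (0 : E) 1, ContDiffAt ℝ 1 (fun y => g ⟪P, y⟫) x := fun x hx =>
    (hgx x hx).comp x ((hρ x).of_le one_le_two)
  have hfield : ∀ x ∈ sphere (0 : E) 1,
      ContDiffAt ℝ 1 (fun y => g ⟪P, y⟫ * carreDuChamp (fun z => ⟪P, z⟫) u y) x := fun x hx =>
    (hgρ x hx).mul (contDiffAt_carreDuChamp (hρ x) (hu.contDiffAt x hx))
  have henergy : ∀ x ∈ sphere (0 : E) 1,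
      ContDiffAt ℝ 1 (fun y => g ⟪P, y⟫ * (carreDuChamp u u y - μ * u y ^ 2)) x := fun x hx =>
    have hux := hu.contDiffAt x hx
    (hgρ x hx).mul ((contDiffAt_carreDuChamp hux hux).sub
      (contDiffAt_const.mul ((hux.of_le one_le_two).pow 2)))
  rw [← integral_linear_combination_carreDuChamp_add_mul_sphericalLaplacian hfield hu.contDiffAt
    henergy (fun x _ => hρ x) (-2)]
  congr 1
  ext x
  have hux := hu.contDiffAt x x.2
  have hgx := (hgx x x.2).differentiableAt one_ne_zero
  rw [carreDuChamp_mul_energy_inner_left hux hP hgx,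
    carreDuChamp_mul ((hgρ x x.2).differentiableAt one_ne_zero)
      ((contDiffAt_carreDuChamp (hρ x) hux).differentiableAt one_ne_zero),
    carreDuChamp_comp hgx ((hρ x).differentiableAt two_ne_zero), hu.sphericalLaplacian_eq x x.2,
    (isSphericalEigenfunction_inner_left P).sphericalLaplacian_eq x x.2]
  ring

end VirialIdentity

section Morawetz

/-- The energy density `|∇u|² + μ u²` on the unit sphere of an eigenfunction `u` with eigenvalue
`μ`. -/
def energyDensity (u : E → ℝ) (μ : ℝ) (x : E) : ℝ := carreDuChamp u u x + μ * u x ^ 2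

variable [MeasurableSpace E] [BorelSpace E] {u : E → ℝ} {g : ℝ → ℝ} {μ : ℝ} {P : E}

theorem morawetz_inequality (hu : IsSphericalEigenfunction u μ) (hP : ‖P‖ = 1)
    (hg : ∀ s ∈ Icc (-1 : ℝ) 1, ContDiffAt ℝ 2 g s) (hg' : ∀ s ∈ Icc (-1 : ℝ) 1, 0 ≤ deriv g s) :
    ∫ x : sphere (0 : E) 1, (⟪P, x⟫ * g ⟪P, x⟫ - (1 - ⟪P, x⟫ ^ 2) * deriv g ⟪P, x⟫) *
        energyDensity u μ x ∂(volume : Measure E).toSphere ≤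
      (Module.finrank ℝ E - 2) / 2 * ∫ x : sphere (0 : E) 1,
        u x ^ 2 * sphericalLaplacian (fun y => ⟪P, y⟫ * g ⟪P, y⟫) x
          ∂(volume : Measure E).toSphere := by
  simp only [energyDensity]
  have hmem : ∀ x ∈ sphere (0 : E) 1, ⟪P, x⟫ ∈ Icc (-1 : ℝ) 1 := fun x hx =>
    real_inner_mem_Icc_of_norm_eq_one hP (by simpa using hx)
  have hρ (x : E) : ContDiffAt ℝ 2 (fun y => ⟪P, y⟫) x := (innerSL ℝ P).contDiff.contDiffAt
  have hf : ∀ x ∈ sphere (0 : E) 1, ContDiffAt ℝ 2 (fun y => ⟪P, y⟫ * g ⟪P, y⟫) x := fun x hx =>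
    (hρ x).mul ((hg _ (hmem x hx)).comp x (hρ x))
  have hint {F : sphere (0 : E) 1 → ℝ} (hF : ∀ x : sphere (0 : E) 1, ContinuousAt u x →
      ContinuousAt (carreDuChamp u u) x → ContinuousAt (carreDuChamp (fun y => ⟪P, y⟫) u) x →
      ContinuousAt g ⟪P, x⟫ → ContinuousAt (deriv g) ⟪P, x⟫ →
      ContinuousAt (sphericalLaplacian (fun y => ⟪P, y⟫ * g ⟪P, y⟫)) x → ContinuousAt F x) :
      Integrable F (volume : Measure E).toSphere := by
    refine integrable_toSphere_of_continuous (continuous_iff_continuousAt.2 fun x => ?_)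
    have hux := (hu.contDiffAt x x.2).of_le one_le_two
    have hgx := hg _ (hmem x x.2)
    exact hF x hux.continuousAt (continuousAt_carreDuChamp hux hux)
      (continuousAt_carreDuChamp ((hρ x).of_le one_le_two) hux)
      hgx.continuousAt (hgx.derivWithin (m := 1) le_rfl).continuousAt
      (continuousAt_sphericalLaplacian (hf x x.2))
  -- The right-hand side is the Pohozaev identity minus `(n - 2) / 2` times the equipartition
  -- identity for `ρ g(ρ)`, so its integral vanishes.
  have hmono : ∫ x : sphere (0 : E) 1, ((⟪P, x⟫ * g ⟪P, x⟫ - (1 - ⟪P, x⟫ ^ 2) * deriv g ⟪P, x⟫) *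
        (carreDuChamp u u x + μ * u x ^ 2) - (Module.finrank ℝ E - 2) / 2 *
        (u x ^ 2 * sphericalLaplacian (fun y => ⟪P, y⟫ * g ⟪P, y⟫) x))
          ∂(volume : Measure E).toSphere ≤
      ∫ x : sphere (0 : E) 1, (deriv g ⟪P, x⟫ * ((1 - ⟪P, x⟫ ^ 2) *
        (carreDuChamp u u x - μ * u x ^ 2) - 2 * carreDuChamp (fun y => ⟪P, y⟫) u x ^ 2) +
        ⟪P, x⟫ * g ⟪P, x⟫ * ((3 - Module.finrank ℝ E) * carreDuChamp u u x +
          (Module.finrank ℝ E - 1) * (μ * u x ^ 2)) - (Module.finrank ℝ E - 2) / 2 *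
        (u x ^ 2 * sphericalLaplacian (fun y => ⟪P, y⟫ * g ⟪P, y⟫) x -
          2 * (⟪P, x⟫ * g ⟪P, x⟫ * (carreDuChamp u u x - μ * u x ^ 2))))
          ∂(volume : Measure E).toSphere := by
    refine integral_mono (hint fun x _ _ _ _ _ _ => by fun_prop)
      (hint fun x _ _ _ _ _ _ => by fun_prop) fun x => ?_
    have := mul_le_mul_of_nonneg_left
      (carreDuChamp_inner_left_sq_le u hP (norm_eq_of_mem_sphere x)) (hg' _ (hmem x x.2))
    linarith
  rw [integral_sub, integral_sub, integral_pohozaev hu hP fun s hs => (hg s hs).of_le one_le_two,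
    integral_const_mul, integral_const_mul, integral_equipartition hu hf] at hmono
  · linarith
  all_goals exact hint fun x _ _ _ _ _ _ => by fun_prop

end Morawetz

section Weight

/-- The weight of the Morawetz inequality, as a function of the height `s = ⟪P, x⟫`. Since
`1 - s = ‖x - P‖ ^ 2 / 2`, it is bounded below on the ball of radius `r` around `P` and decays like
`r / ‖x - P‖` away from it. -/
def ballWeight (r s : ℝ) : ℝ := r / √(r ^ 2 + 1 - s)

variable {r s : ℝ}

theorem ballWeight_nonneg (hr : 0 ≤ r) (s : ℝ) : 0 ≤ ballWeight r s :=
  div_nonneg hr (Real.sqrt_nonneg _)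

theorem ballWeight_sq_mul (hs : 0 < r ^ 2 + 1 - s) :
    ballWeight r s ^ 2 * (r ^ 2 + 1 - s) = r ^ 2 := by
  rw [ballWeight, div_pow, Real.sq_sqrt hs.le, div_mul_cancel₀ _ hs.ne']

theorem hasDerivAt_ballWeight (hs : 0 < r ^ 2 + 1 - s) :
    HasDerivAt (ballWeight r) (ballWeight r s ^ 3 / (2 * r ^ 2)) s := by
  have hT := (Real.sqrt_pos.2 hs).ne'
  have h := (hasDerivAt_const s r).div
    (((hasDerivAt_id s).const_sub (r ^ 2 + 1)).sqrt hs.ne') hT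
  refine h.congr_deriv ?_
  simp only [id, ballWeight]
  field_simp
  ring

theorem contDiffAt_ballWeight {n : WithTop ℕ∞} (hs : 0 < r ^ 2 + 1 - s) :
    ContDiffAt ℝ n (ballWeight r) s :=
  contDiffAt_const.div ((contDiffAt_const.sub contDiffAt_id).sqrt hs.ne') (Real.sqrt_pos.2 hs).ne'

theorem contDiffAt_ballWeight_inner {F : Type*} [NormedAddCommGroup F] [InnerProductSpace ℝ F]
    {P x : F} {n : WithTop ℕ∞} (hP : ‖P‖ = 1) (hx : ‖x‖ = 1) (hr : 0 < r) :
    ContDiffAt ℝ n (fun y => ballWeight r ⟪P, y⟫) x :=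
  (contDiffAt_ballWeight (by nlinarith [real_inner_mem_Icc_of_norm_eq_one hP hx |>.2])).comp x
    (innerSL ℝ P).contDiff.contDiffAt

theorem hasDerivAt_id_mul_ballWeight (hs : 0 < r ^ 2 + 1 - s) :
    HasDerivAt (fun s => s * ballWeight r s)
      (ballWeight r s + s * ballWeight r s ^ 3 / (2 * r ^ 2)) s := by
  refine ((hasDerivAt_id s).mul (hasDerivAt_ballWeight hs)).congr_deriv ?_
  simp only [id]
  ring

theorem deriv_deriv_id_mul_ballWeight (hr : r ≠ 0) (hs : 0 < r ^ 2 + 1 - s) :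
    deriv (deriv fun s => s * ballWeight r s) s =
      ballWeight r s ^ 3 / r ^ 2 + 3 * s * ballWeight r s ^ 5 / (4 * r ^ 4) := by
  have hnhds : ∀ᶠ t in nhds s, 0 < r ^ 2 + 1 - t :=
    ContinuousAt.eventually_lt (by fun_prop) (by fun_prop) hs
  have hderiv : deriv (fun s => s * ballWeight r s) =ᶠ[nhds s] fun s =>
      ballWeight r s + s * ballWeight r s ^ 3 / (2 * r ^ 2) :=
    hnhds.mono fun t ht => (hasDerivAt_id_mul_ballWeight ht).deriv
  have hg := hasDerivAt_ballWeight hs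
  rw [hderiv.deriv_eq]
  refine ((hg.add (((hasDerivAt_id s).mul (hg.pow 3)).div_const _)).congr_deriv ?_).deriv
  simp only [id, Pi.pow_apply]
  field_simp
  ring

theorem one_sub_mul_ballWeight_le (hr : 0 < r) (hs : -1 ≤ s) (hs' : s ≤ 1) :
    (1 - s) * ballWeight r s ≤ 2 * r := by
  have hg := ballWeight_sq_mul (r := r) (s := s) (by nlinarith)
  have hsq : (1 - s) * ballWeight r s ^ 2 ≤ r ^ 2 := by
    nlinarith [mul_nonneg (sq_nonneg r) (sq_nonneg (ballWeight r s))]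
  refine abs_le_of_sq_le_sq' ?_ (by positivity) |>.2
  calc ((1 - s) * ballWeight r s) ^ 2 = (1 - s) * ((1 - s) * ballWeight r s ^ 2) := by ring
    _ ≤ 4 * r ^ 2 := by nlinarith [mul_le_mul_of_nonneg_left hsq (sub_nonneg.2 hs')]
    _ = (2 * r) ^ 2 := by ring

theorem le_id_mul_ballWeight_sub (hr : 0 < r) (hs : -1 ≤ s) (hs' : s ≤ 1) :
    ballWeight r s ^ 3 - 2 * r ≤
      s * ballWeight r s - (1 - s ^ 2) * (ballWeight r s ^ 3 / (2 * r ^ 2)) := by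
  have hg := ballWeight_sq_mul (r := r) (s := s) (by nlinarith)
  have hg0 := ballWeight_nonneg hr.le s
  have hle := one_sub_mul_ballWeight_le hr hs hs'
  have hid : s * ballWeight r s - (1 - s ^ 2) * (ballWeight r s ^ 3 / (2 * r ^ 2)) =
      ballWeight r s ^ 3 - (1 - s) * ballWeight r s +
        (1 - s) ^ 2 * ballWeight r s ^ 3 / (2 * r ^ 2) := by
    field_simp
    linear_combination (-2 : ℝ) * ballWeight r s * hg
  have : 0 ≤ (1 - s) ^ 2 * ballWeight r s ^ 3 / (2 * r ^ 2) := by positivity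
  linarith

-- The left-hand side is `(Δ(ρ g(ρ)) + 3 ρ g(ρ)) / g(ρ)` on the three-sphere at height `s`, for the
-- weight `g = ballWeight r`, in terms of `G = g² / r²`.
theorem laplacian_id_mul_ballWeight_le_three {G : ℝ} (hs : -1 ≤ s) (hs' : s ≤ 1) (hG : 0 ≤ G)
    (hGs : (1 - s) * G ≤ 1) :
    (1 - s ^ 2) * (G + 3 / 4 * s * G ^ 2) - 3 / 2 * s ^ 2 * G ≤ 3 := by
  have hlin : (1 + s) * ((1 - s) * G) ≤ 1 + s := mul_le_of_le_one_right (by linarith) hGs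
  have hid : (1 - s ^ 2) * (G + 3 / 4 * s * G ^ 2) - 3 / 2 * s ^ 2 * G =
      (1 + s) * ((1 - s) * G) + 3 / 4 * s * G * ((1 + s) * ((1 - s) * G) - 2 * s) := by ring
  rw [hid]
  rcases le_total 0 s with h | h
  · have : 3 / 4 * s * G * ((1 + s) * ((1 - s) * G) - 2 * s) ≤ 3 / 4 * s * ((1 - s) * G) := by
      nlinarith [mul_le_mul_of_nonneg_left hlin (mul_nonneg h hG)]
    nlinarith
  · have : 0 ≤ -s * G * ((1 + s) * ((1 - s) * G) - 2 * s) :=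
      mul_nonneg (mul_nonneg (by linarith) hG)
        (by nlinarith [mul_nonneg (mul_nonneg (neg_le_iff_add_nonneg'.1 hs) (sub_nonneg.2 hs')) hG])
    nlinarith

theorem laplacian_id_mul_ballWeight_le {n : ℝ} (hn : 4 ≤ n) (hr : 0 < r) (hs : -1 ≤ s)
    (hs' : s ≤ 1) :
    (1 - s ^ 2) * (ballWeight r s ^ 3 / r ^ 2 + 3 * s * ballWeight r s ^ 5 / (4 * r ^ 4)) -
      (n - 1) * s * (ballWeight r s + s * ballWeight r s ^ 3 / (2 * r ^ 2)) ≤ (n + 2) * r := by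
  have hg := ballWeight_sq_mul (r := r) (s := s) (by nlinarith)
  have hg0 := ballWeight_nonneg hr.le s
  have hle := one_sub_mul_ballWeight_le hr hs hs'
  set g := ballWeight r s
  obtain ⟨G, hG⟩ : ∃ G, G = g ^ 2 / r ^ 2 := ⟨_, rfl⟩
  have hG0 : 0 ≤ G := hG ▸ by positivity
  have hGs : G * (r ^ 2 + 1 - s) = 1 := by
    rw [hG, div_mul_eq_mul_div, hg, div_self (by positivity)]
  have hfour := mul_le_mul_of_nonneg_left
    (laplacian_id_mul_ballWeight_le_three hs hs' hG0 (by nlinarith)) hg0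
  have hgr : -(s * g) ≤ r := by
    rcases le_total 0 s with h | h
    · nlinarith [mul_nonneg h hg0]
    · have : g ≤ r := abs_le_of_sq_le_sq' (by nlinarith [sq_nonneg g]) hr.le |>.2
      nlinarith
  have hid : (1 - s ^ 2) * (g ^ 3 / r ^ 2 + 3 * s * g ^ 5 / (4 * r ^ 4)) -
      (n - 1) * s * (g + s * g ^ 3 / (2 * r ^ 2)) =
      g * ((1 - s ^ 2) * (G + 3 / 4 * s * G ^ 2) - 3 / 2 * s ^ 2 * G) - 3 * (s * g) +
        (n - 4) * (-(s * g)) - (n - 4) * (s ^ 2 * g ^ 3 / (2 * r ^ 2)) := by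
    rw [hG]
    field_simp
    ring
  have hexcess := mul_le_mul_of_nonneg_left hgr (sub_nonneg.2 hn)
  have := mul_nonneg (sub_nonneg.2 hn) (by positivity : 0 ≤ s ^ 2 * g ^ 3 / (2 * r ^ 2))
  linarith

theorem half_le_ballWeight_pow (hr : 0 < r) (hs : 1 - r ^ 2 / 2 ≤ s) (hs' : s ≤ 1) :
    1 / 2 ≤ ballWeight r s ^ 3 := by
  have hg := ballWeight_sq_mul (r := r) (s := s) (by nlinarith)
  have hg0 := ballWeight_nonneg hr.le s
  have hsq : 2 / 3 ≤ ballWeight r s ^ 2 := by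
    by_contra! h
    nlinarith [sq_nonneg (ballWeight r s), pow_pos hr 2]
  have : 4 / 5 ≤ ballWeight r s := by nlinarith
  nlinarith

end Weight

theorem one_sub_le_inner_of_mem_closedBall {F : Type*} [NormedAddCommGroup F]
    [InnerProductSpace ℝ F] {P x : sphere (0 : F) 1} {r : ℝ} (hx : x ∈ closedBall P r) :
    1 - r ^ 2 / 2 ≤ ⟪(P : F), x⟫ := by
  have hdist : ‖(x : F) - P‖ ^ 2 ≤ r ^ 2 := by
    gcongr
    simpa [Subtype.dist_eq, dist_eq_norm] using hx
  rw [norm_sub_sq_real, norm_eq_of_mem_sphere, norm_eq_of_mem_sphere, real_inner_comm] at hdist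
  linarith

section MassEstimate

variable {u : E → ℝ} {μ r : ℝ} {P : E}

theorem sphericalLaplacian_inner_mul_ballWeight_le {x : E} (hP : ‖P‖ = 1) (hx : ‖x‖ = 1)
    (hr : 0 < r) (hn : 4 ≤ Module.finrank ℝ E) :
    sphericalLaplacian (fun y => ⟪P, y⟫ * ballWeight r ⟪P, y⟫) x ≤
      (Module.finrank ℝ E + 2) * r := by
  obtain ⟨hs, hs'⟩ := real_inner_mem_Icc_of_norm_eq_one hP hx
  have hpos : 0 < r ^ 2 + 1 - ⟪P, x⟫ := by nlinarith
  rw [sphericalLaplacian_comp_inner_left (φ := fun s => s * ballWeight r s) hP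
    (contDiffAt_id.mul (contDiffAt_ballWeight hpos)), deriv_deriv_id_mul_ballWeight hr.ne' hpos,
    (hasDerivAt_id_mul_ballWeight hpos).deriv]
  exact laplacian_id_mul_ballWeight_le (by exact_mod_cast hn) hr hs hs'

theorem IsSphericalEigenfunction.continuous (hu : IsSphericalEigenfunction u μ) :
    Continuous fun x : sphere (0 : E) 1 => u x :=
  continuous_comp_coe_sphere fun x hx => (hu.contDiffAt x hx).continuousAt

theorem IsSphericalEigenfunction.continuous_energyDensity (hu : IsSphericalEigenfunction u μ) :
    Continuous fun x : sphere (0 : E) 1 => energyDensity u μ x :=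
  continuous_comp_coe_sphere fun x hx => by
    have hux := (hu.contDiffAt x hx).of_le one_le_two
    exact (continuousAt_carreDuChamp hux hux).add ((hux.continuousAt.pow 2).const_mul μ)

theorem energyDensity_nonneg (u : E → ℝ) (hμ : 0 ≤ μ) {x : E} (hx : ‖x‖ = 1) :
    0 ≤ energyDensity u μ x :=
  add_nonneg (carreDuChamp_self_nonneg u hx) (mul_nonneg hμ (sq_nonneg _))

theorem mul_sq_le_ballWeight_pow_mul_energyDensity (u : E → ℝ) (hμ : 0 ≤ μ) (hr : 0 < r)
    {P x : sphere (0 : E) 1} (hx : x ∈ closedBall P r) :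
    μ / 2 * u x ^ 2 ≤ ballWeight r ⟪(P : E), x⟫ ^ 3 * energyDensity u μ x := by
  have hweight := half_le_ballWeight_pow hr (one_sub_le_inner_of_mem_closedBall hx)
    (real_inner_mem_Icc_of_norm_eq_one (by simp) (by simp)).2
  calc μ / 2 * u x ^ 2 = 1 / 2 * (μ * u x ^ 2) := by ring
    _ ≤ ballWeight r ⟪(P : E), x⟫ ^ 3 * energyDensity u μ x := by
      gcongr
      exact le_add_of_nonneg_left (carreDuChamp_self_nonneg u (by simp))

variable [MeasurableSpace E] [BorelSpace E]

theorem IsSphericalEigenfunction.integrable_sq (hu : IsSphericalEigenfunction u μ) :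
    Integrable (fun x : sphere (0 : E) 1 => u x ^ 2) (volume : Measure E).toSphere :=
  integrable_toSphere_of_continuous (hu.continuous.pow 2)

theorem IsSphericalEigenfunction.integrable_energyDensity (hu : IsSphericalEigenfunction u μ) :
    Integrable (fun x : sphere (0 : E) 1 => energyDensity u μ x) (volume : Measure E).toSphere :=
  integrable_toSphere_of_continuous hu.continuous_energyDensity

theorem IsSphericalEigenfunction.integral_energyDensity (hu : IsSphericalEigenfunction u μ) :
    ∫ x : sphere (0 : E) 1, energyDensity u μ x ∂(volume : Measure E).toSphere =
      2 * μ * ∫ x : sphere (0 : E) 1, u x ^ 2 ∂(volume : Measure E).toSphere := by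
  rw [← integral_const_mul, ← sub_eq_zero, ← integral_sub hu.integrable_energyDensity
    (hu.integrable_sq.const_mul _), ← integral_carreDuChamp_add_mul_sphericalLaplacian
      (fun x hx => (hu.contDiffAt x hx).of_le one_le_two) hu.contDiffAt]
  refine integral_congr_ae (.of_forall fun x => ?_)
  simp only [hu.sphericalLaplacian_eq x x.2, energyDensity]
  ring

theorem IsSphericalEigenfunction.integrable_ballWeight_pow_mul_energyDensity
    (hu : IsSphericalEigenfunction u μ) (hP : ‖P‖ = 1) (hr : 0 < r) :
    Integrable (fun x : sphere (0 : E) 1 => ballWeight r ⟪P, x⟫ ^ 3 * energyDensity u μ x)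
      (volume : Measure E).toSphere :=
  integrable_toSphere_of_continuous <| ((continuous_comp_coe_sphere fun _ hx =>
    (contDiffAt_ballWeight_inner (n := 2) hP (by simpa using hx) hr).continuousAt).pow 3).mul
      hu.continuous_energyDensity

theorem integral_sq_mul_sphericalLaplacian_inner_mul_ballWeight_le
    (hu : Continuous fun x : sphere (0 : E) 1 => u x) (hP : ‖P‖ = 1) (hr : 0 < r)
    (hn : 4 ≤ Module.finrank ℝ E) :
    ∫ x : sphere (0 : E) 1, u x ^ 2 * sphericalLaplacian (fun y => ⟪P, y⟫ * ballWeight r ⟪P, y⟫) x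
        ∂(volume : Measure E).toSphere ≤
      (Module.finrank ℝ E + 2) * r *
        ∫ x : sphere (0 : E) 1, u x ^ 2 ∂(volume : Measure E).toSphere := by
  rw [← integral_const_mul]
  refine integral_mono (integrable_toSphere_of_continuous ((hu.pow 2).mul
    (continuous_comp_coe_sphere fun x hx => continuousAt_sphericalLaplacian
      ((innerSL ℝ P).contDiff.contDiffAt.mul
        (contDiffAt_ballWeight_inner (n := 2) hP (by simpa using hx) hr)))))
    (integrable_toSphere_of_continuous ((hu.pow 2).const_mul _)) fun x => ?_
  exact (mul_comm _ _).trans_le <| mul_le_mul_of_nonneg_right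
    (sphericalLaplacian_inner_mul_ballWeight_le hP (norm_eq_of_mem_sphere x) hr hn)
    (sq_nonneg (u x))

theorem IsSphericalEigenfunction.integral_ballWeight_pow_mul_energyDensity_le
    (hu : IsSphericalEigenfunction u μ) (hμ : 0 ≤ μ) (hn : 4 ≤ Module.finrank ℝ E)
    (hP : ‖P‖ = 1) (hr : 0 < r) :
    ∫ x : sphere (0 : E) 1, ballWeight r ⟪P, x⟫ ^ 3 * energyDensity u μ x
        ∂(volume : Measure E).toSphere ≤
      (4 * μ + ((Module.finrank ℝ E : ℝ) ^ 2 - 4) / 2) * r *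
        ∫ x : sphere (0 : E) 1, u x ^ 2 ∂(volume : Measure E).toSphere := by
  have hmem (x : sphere (0 : E) 1) : ⟪P, x⟫ ∈ Icc (-1 : ℝ) 1 :=
    real_inner_mem_Icc_of_norm_eq_one hP (by simp)
  have hpos : ∀ s ∈ Icc (-1 : ℝ) 1, 0 < r ^ 2 + 1 - s := fun s hs => by nlinarith [hs.2]
  have he := hu.integrable_energyDensity
  have hwe := hu.integrable_ballWeight_pow_mul_energyDensity hP hr
  have hρ : Continuous fun x : sphere (0 : E) 1 => ⟪P, x⟫ := by fun_prop
  have hw : Continuous fun x : sphere (0 : E) 1 => ballWeight r ⟪P, x⟫ :=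
    continuous_comp_coe_sphere fun x hx =>
      (contDiffAt_ballWeight_inner (n := 2) hP (by simpa using hx) hr).continuousAt
  have hmorawetz := morawetz_inequality hu hP (fun s hs => contDiffAt_ballWeight (hpos s hs))
    (fun s hs => (hasDerivAt_ballWeight (hpos s hs)).deriv ▸
      div_nonneg (pow_nonneg (ballWeight_nonneg hr.le s) 3) (by positivity))
  simp only [fun x => (hasDerivAt_ballWeight (hpos _ (hmem x))).deriv] at hmorawetz
  have hlower : ∫ x : sphere (0 : E) 1, (ballWeight r ⟪P, x⟫ ^ 3 * energyDensity u μ x -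
      2 * r * energyDensity u μ x) ∂(volume : Measure E).toSphere ≤
      (Module.finrank ℝ E - 2) / 2 * ∫ x : sphere (0 : E) 1,
        u x ^ 2 * sphericalLaplacian (fun y => ⟪P, y⟫ * ballWeight r ⟪P, y⟫) x
          ∂(volume : Measure E).toSphere := by
    refine (integral_mono (hwe.sub (he.const_mul _)) (integrable_toSphere_of_continuous
      (((hρ.mul hw).sub ((continuous_const.sub (hρ.pow 2)).mul ((hw.pow 3).div_const _))).mul
        hu.continuous_energyDensity)) fun x => ?_).trans hmorawetz
    exact (sub_mul _ _ _).symm.trans_le <|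
      mul_le_mul_of_nonneg_right (le_id_mul_ballWeight_sub hr (hmem x).1 (hmem x).2)
        (energyDensity_nonneg u hμ (by simp))
  rw [integral_sub hwe (he.const_mul _), integral_const_mul, hu.integral_energyDensity] at hlower
  have hupper := integral_sq_mul_sphericalLaplacian_inner_mul_ballWeight_le hu.continuous hP hr hn
  have hn' : (4 : ℝ) ≤ Module.finrank ℝ E := by exact_mod_cast hn
  have := mul_le_mul_of_nonneg_left hupper (by linarith : 0 ≤ ((Module.finrank ℝ E : ℝ) - 2) / 2)
  linarith

theorem IsSphericalEigenfunction.setIntegral_closedBall_sq_le (hu : IsSphericalEigenfunction u μ)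
    (hμ : (Module.finrank ℝ E : ℝ) - 1 ≤ μ) (hn : 4 ≤ Module.finrank ℝ E) (P : sphere (0 : E) 1)
    (hr : 0 < r) :
    ∫ x in closedBall P r, u x ^ 2 ∂(volume : Measure E).toSphere ≤
      (Module.finrank ℝ E + 9) * r *
        ∫ x : sphere (0 : E) 1, u x ^ 2 ∂(volume : Measure E).toSphere := by
  have hn' : (4 : ℝ) ≤ Module.finrank ℝ E := by exact_mod_cast hn
  have hμ0 : 0 < μ := by linarith
  have hmass : μ / 2 * ∫ x in closedBall P r, u x ^ 2 ∂(volume : Measure E).toSphere ≤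
      (4 * μ + ((Module.finrank ℝ E : ℝ) ^ 2 - 4) / 2) * r *
        ∫ x : sphere (0 : E) 1, u x ^ 2 ∂(volume : Measure E).toSphere := by
    have hint := hu.integrable_ballWeight_pow_mul_energyDensity (norm_eq_of_mem_sphere P) hr
    rw [← integral_const_mul]
    calc ∫ x in closedBall P r, μ / 2 * u x ^ 2 ∂(volume : Measure E).toSphere
      _ ≤ ∫ x in closedBall P r, ballWeight r ⟪(P : E), x⟫ ^ 3 * energyDensity u μ x
            ∂(volume : Measure E).toSphere :=
        setIntegral_mono_on (hu.integrable_sq.const_mul _).integrableOn hint.integrableOn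
          isClosed_closedBall.measurableSet
          fun x hx => mul_sq_le_ballWeight_pow_mul_energyDensity u hμ0.le hr hx
      _ ≤ ∫ x : sphere (0 : E) 1, ballWeight r ⟪(P : E), x⟫ ^ 3 * energyDensity u μ x
            ∂(volume : Measure E).toSphere :=
        setIntegral_le_integral hint <| .of_forall fun x =>
          mul_nonneg (pow_nonneg (ballWeight_nonneg hr.le _) 3)
            (energyDensity_nonneg u hμ0.le (norm_eq_of_mem_sphere x))
      _ ≤ _ := hu.integral_ballWeight_pow_mul_energyDensity_le hμ0.le hn
            (norm_eq_of_mem_sphere P) hr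
  have hconst : 4 * μ + ((Module.finrank ℝ E : ℝ) ^ 2 - 4) / 2 ≤
      μ / 2 * (Module.finrank ℝ E + 9) := by nlinarith
  refine le_of_mul_le_mul_left (hmass.trans ?_) (half_pos hμ0)
  rw [← mul_assoc, ← mul_assoc]
  gcongr

end MassEstimate

section SolidHarmonic

/-- `u` is a solid harmonic of degree `d`: a harmonic function on the whole space, homogeneous of
degree `d`. -/
structure IsSolidHarmonic (u : E → ℝ) (d : ℕ) : Prop where
  contDiff : ContDiff ℝ 2 u
  laplacian_eq_zero : ∀ x, Δ u x = 0
  map_smul : ∀ (c : ℝ) (x : E), u (c • x) = c ^ d * u x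

variable {u : E → ℝ} {d : ℕ}

theorem IsSolidHarmonic.fderiv_apply_self (hu : IsSolidHarmonic u d) (x : E) :
    fderiv ℝ u x x = d * u x := by
  have hcomp : HasDerivAt (fun c : ℝ => u (c • x)) (fderiv ℝ u x x) 1 := by
    have hline : HasDerivAt (fun c : ℝ => c • x) x 1 := by
      simpa using (hasDerivAt_id (1 : ℝ)).smul_const x
    refine HasFDerivAt.comp_hasDerivAt (1 : ℝ) ?_ hline
    simpa using (hu.contDiff.differentiable two_ne_zero x).hasFDerivAt
  simp only [hu.map_smul] at hcomp
  simpa using hcomp.unique ((hasDerivAt_pow d (1 : ℝ)).mul_const (u x))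

theorem IsSolidHarmonic.fderiv_fderiv_apply_self (hu : IsSolidHarmonic u d) (x : E) :
    fderiv ℝ (fderiv ℝ u) x x x = d * (d - 1) * u x := by
  have hdiff :=
    ((hu.contDiff.fderiv_right (m := 1) le_rfl).differentiable one_ne_zero x).hasFDerivAt
  have heuler := (hdiff.clm_apply (hasFDerivAt_id x)).unique <| by
    simpa only [id, hu.fderiv_apply_self] using
      ((hu.contDiff.differentiable two_ne_zero x).hasFDerivAt.const_mul (d : ℝ))
  have := congrArg (· x) heuler
  simp [hu.fderiv_apply_self] at this
  linarith

theorem IsSolidHarmonic.isSphericalEigenfunction (hu : IsSolidHarmonic u d) :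
    IsSphericalEigenfunction u (d * (d + Module.finrank ℝ E - 2)) where
  contDiffAt x _ := hu.contDiff.contDiffAt
  sphericalLaplacian_eq x _ := by
    rw [sphericalLaplacian, hu.laplacian_eq_zero, hu.fderiv_fderiv_apply_self,
      hu.fderiv_apply_self]
    ring

theorem IsSolidHarmonic.eq_const (hu : IsSolidHarmonic u 0) (x : E) : u x = u 0 := by
  simpa using (hu.map_smul 0 x).symm

variable [MeasurableSpace E] [BorelSpace E] {r : ℝ}

theorem measureReal_closedBall_le (hn : 4 ≤ Module.finrank ℝ E) (P : sphere (0 : E) 1)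
    (hr : 0 < r) :
    (volume : Measure E).toSphere.real (closedBall P r) ≤
      4 * (Module.finrank ℝ E + 9) * r * (volume : Measure E).toSphere.real univ := by
  rcases lt_or_ge 1 r with hr1 | hr1
  · refine (measureReal_mono (subset_univ _)).trans (le_mul_of_one_le_left measureReal_nonneg ?_)
    nlinarith [(Module.finrank ℝ E).cast_nonneg (α := ℝ)]
  have hρ := isSphericalEigenfunction_inner_left (P : E)
  have hsq (x : sphere (0 : E) 1) (hx : x ∈ closedBall P r) : 1 ≤ 4 * ⟪(P : E), x⟫ ^ 2 := by
    have hx' := one_sub_le_inner_of_mem_closedBall hx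
    have : 1 / 2 ≤ ⟪(P : E), x⟫ := by nlinarith
    nlinarith
  have hle (x : sphere (0 : E) 1) : ⟪(P : E), x⟫ ^ 2 ≤ 1 :=
    (sq_le_one_iff_abs_le_one _).2 <| abs_le.2 <|
      real_inner_mem_Icc_of_norm_eq_one (norm_eq_of_mem_sphere P) (norm_eq_of_mem_sphere x)
  calc (volume : Measure E).toSphere.real (closedBall P r)
    _ = ∫ x in closedBall P r, 1 ∂(volume : Measure E).toSphere := by simp
    _ ≤ ∫ x in closedBall P r, 4 * ⟪(P : E), x⟫ ^ 2 ∂(volume : Measure E).toSphere :=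
      setIntegral_mono_on (integrable_const _).integrableOn
        (hρ.integrable_sq.const_mul 4).integrableOn isClosed_closedBall.measurableSet hsq
    _ = 4 * ∫ x in closedBall P r, ⟪(P : E), x⟫ ^ 2 ∂(volume : Measure E).toSphere :=
      integral_const_mul _ _
    _ ≤ 4 * ((Module.finrank ℝ E + 9) * r *
        ∫ x : sphere (0 : E) 1, ⟪(P : E), x⟫ ^ 2 ∂(volume : Measure E).toSphere) := by
      gcongr
      exact hρ.setIntegral_closedBall_sq_le le_rfl hn P hr
    _ ≤ 4 * ((Module.finrank ℝ E + 9) * r *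
        ∫ x : sphere (0 : E) 1, 1 ∂(volume : Measure E).toSphere) := by
      gcongr 4 * (_ * r * ?_)
      exact integral_mono hρ.integrable_sq (integrable_const _) hle
    _ = _ := by simp; ring

theorem IsSolidHarmonic.setIntegral_closedBall_sq_le (hu : IsSolidHarmonic u d)
    (hn : 4 ≤ Module.finrank ℝ E) (P : sphere (0 : E) 1) (hr : 0 < r) :
    ∫ x in closedBall P r, u x ^ 2 ∂(volume : Measure E).toSphere ≤
      4 * (Module.finrank ℝ E + 9) * r *
        ∫ x : sphere (0 : E) 1, u x ^ 2 ∂(volume : Measure E).toSphere := by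
  rcases eq_or_ne d 0 with rfl | hd
  · have := mul_le_mul_of_nonneg_right (measureReal_closedBall_le hn P hr) (sq_nonneg (u 0))
    simpa [hu.eq_const _, mul_assoc] using this
  · have hd1 : (1 : ℝ) ≤ d := by exact_mod_cast Nat.one_le_iff_ne_zero.2 hd
    have hn' : (4 : ℝ) ≤ Module.finrank ℝ E := by exact_mod_cast hn
    have hmass := hu.isSphericalEigenfunction.setIntegral_closedBall_sq_le (by nlinarith) hn P hr
    refine hmass.trans ?_
    gcongr ?_ * r * _
    linarith

end SolidHarmonic

section Polynomial

variable {ι : Type*}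

/-- The complex-valued function on Euclidean space defined by a polynomial. It extends the function
`polyRestrict p` beyond the sphere, where it can be differentiated. -/
def polyEval (p : MvPolynomial ι ℂ) (x : EuclideanSpace ℝ ι) : ℂ :=
  MvPolynomial.eval (fun i => (x i : ℂ)) p

theorem polyEval_smul {p : MvPolynomial ι ℂ} {d : ℕ} (hp : p.IsHomogeneous d) (c : ℝ)
    (x : EuclideanSpace ℝ ι) : polyEval p (c • x) = (c : ℂ) ^ d * polyEval p x := by
  simp only [polyEval, MvPolynomial.eval_eq, Finset.mul_sum]
  refine Finset.sum_congr rfl fun m hm => ?_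
  have hdeg : ∑ i ∈ m.support, m i = d :=
    not_not.1 fun h => MvPolynomial.mem_support_iff.1 hm (hp.coeff_eq_zero h)
  simp only [PiLp.smul_apply, smul_eq_mul, Complex.ofReal_mul, mul_pow, Finset.prod_mul_distrib,
    Finset.prod_pow_eq_pow_sum, hdeg]
  ring

variable [Fintype ι]

theorem contDiff_polyEval (p : MvPolynomial ι ℂ) {n : WithTop ℕ∞} : ContDiff ℝ n (polyEval p) := by
  unfold polyEval
  induction p using MvPolynomial.induction_on with
  | C a => simpa using contDiff_const
  | add p q hp hq => simpa using hp.add hq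
  | mul_X p i hp =>
    simpa using hp.mul (Complex.ofRealCLM.contDiff.comp
      (EuclideanSpace.proj (𝕜 := ℝ) i).contDiff)

theorem fderiv_polyEval_single [DecidableEq ι] (p : MvPolynomial ι ℂ) (x : EuclideanSpace ℝ ι)
    (i : ι) :
    fderiv ℝ (polyEval p) x (EuclideanSpace.single i 1) = polyEval (MvPolynomial.pderiv i p) x := by
  have hdiff (p : MvPolynomial ι ℂ) : HasFDerivAt (polyEval p) (fderiv ℝ (polyEval p) x) x :=
    ((contDiff_polyEval p (n := 1)).differentiable one_ne_zero x).hasFDerivAt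
  induction p using MvPolynomial.induction_on with
  | C a =>
    have hconst : polyEval (MvPolynomial.C a : MvPolynomial ι ℂ) = fun _ => a :=
      funext fun y => MvPolynomial.eval_C a
    simp [hconst, polyEval]
  | add p q hp hq =>
    have hsum : polyEval (p + q) = polyEval p + polyEval q := funext fun y => map_add _ p q
    rw [hsum, ((hdiff p).add (hdiff q)).fderiv]
    simp [hp, hq, polyEval]
  | mul_X p k hp =>
    have hmul : polyEval (p * MvPolynomial.X k) = polyEval p * fun y => (y k : ℂ) :=
      funext fun y => by simp [polyEval]
    have hcoord : HasFDerivAt (fun y : EuclideanSpace ℝ ι => (y k : ℂ))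
        (Complex.ofRealCLM ∘L EuclideanSpace.proj k) x :=
      (Complex.ofRealCLM ∘L EuclideanSpace.proj (𝕜 := ℝ) k).hasFDerivAt
    rw [hmul, ((hdiff p).mul hcoord).fderiv]
    rcases eq_or_ne k i with rfl | hki
    · simp [hp, polyEval, mul_comm]
    · simp [hp, polyEval, mul_comm, hki, MvPolynomial.pderiv_X_of_ne hki]

theorem laplacian_polyEval (p : MvPolynomial ι ℂ) (x : EuclideanSpace ℝ ι) :
    Δ (polyEval p) x = ∑ i, polyEval (MvPolynomial.pderiv i (MvPolynomial.pderiv i p)) x := by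
  classical
  rw [laplacian_eq_iteratedFDeriv_orthonormalBasis _ (EuclideanSpace.basisFun ι ℝ)]
  refine Finset.sum_congr rfl fun i _ => ?_
  have hdiff := ((contDiff_polyEval p (n := 2)).fderiv_right (m := 1) le_rfl).differentiable
    one_ne_zero x
  have hpartial : (fun y => fderiv ℝ (polyEval p) y (EuclideanSpace.single i 1)) =
    polyEval (MvPolynomial.pderiv i p) := funext fun y => fderiv_polyEval_single p y i
  rw [iteratedFDeriv_two_apply, ← fderiv_polyEval_single, ← hpartial,
    fderiv_clm_apply hdiff (differentiableAt_const _)]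
  simp

theorem isSolidHarmonic_polyEval {p : MvPolynomial (Fin 4) ℂ} {d : ℕ} (hp : p ∈ harmonicPoly d)
    (L : ℂ →L[ℝ] ℝ) : IsSolidHarmonic (fun x => L (polyEval p x)) d where
  contDiff := L.contDiff.comp (contDiff_polyEval p)
  laplacian_eq_zero x := by
    have hΔ : Δ (polyEval p) x = 0 := by
      rw [laplacian_polyEval]
      simpa [polyLaplacian, polyEval] using
        congrArg (fun q => polyEval q x) (LinearMap.mem_ker.1 hp.2)
    exact (contDiff_polyEval p).contDiffAt.laplacian_CLM_comp_left.trans (by simp [hΔ])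
  map_smul c x := by
    rw [polyEval_smul hp.1, ← Complex.ofReal_pow, ← Complex.real_smul, map_smul, smul_eq_mul]

end Polynomial

section Operator

theorem norm_comp_comm_of_isSelfAdjoint {𝕜 H : Type*} [RCLike 𝕜] [NormedAddCommGroup H]
    [InnerProductSpace 𝕜 H] [CompleteSpace H] {A B : H →L[𝕜] H} (hA : IsSelfAdjoint A)
    (hB : IsSelfAdjoint B) : ‖A ∘L B‖ = ‖B ∘L A‖ := by
  rw [← ContinuousLinearMap.adjoint.norm_map (A ∘L B), ContinuousLinearMap.adjoint_comp,
    hA.adjoint_eq, hB.adjoint_eq]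

theorem norm_sq_eq_integral {α F : Type*} [MeasurableSpace α] {μ : Measure α}
    [NormedAddCommGroup F] (f : Lp F 2 μ) : ‖f‖ ^ 2 = ∫ x, ‖f x‖ ^ 2 ∂μ := by
  have hnorm : ‖f‖ = √(∫ x, ‖f x‖ ^ 2 ∂μ) := by
    rw [Lp.norm_def, toReal_eLpNorm (Lp.aestronglyMeasurable f),
      lpNorm_eq_integral_norm_rpow_toReal two_ne_zero ENNReal.ofNat_ne_top
        (Lp.aestronglyMeasurable f), Real.sqrt_eq_rpow]
    norm_num
  rw [hnorm, Real.sq_sqrt (by positivity)]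

theorem coeFn_mulIndicator {A : Set S3} (hA : MeasurableSet A) (f : L2) :
    mulIndicator A hA f =ᵐ[surf] A.indicator f :=
  coeFn_indicatorMul A hA f

theorem norm_sq_mulIndicator {A : Set S3} (hA : MeasurableSet A) (f : L2) :
    ‖mulIndicator A hA f‖ ^ 2 = ∫ x in A, ‖f x‖ ^ 2 ∂surf := by
  rw [norm_sq_eq_integral, ← integral_indicator hA]
  refine integral_congr_ae ?_
  filter_upwards [coeFn_mulIndicator hA f] with x hx
  by_cases hm : x ∈ A <;> simp [hx, hm]

theorem isSelfAdjoint_mulIndicator {A : Set S3} (hA : MeasurableSet A) :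
    IsSelfAdjoint (mulIndicator A hA) := by
  rw [ContinuousLinearMap.isSelfAdjoint_iff_isSymmetric]
  intro f g
  simp only [ContinuousLinearMap.coe_coe, L2.inner_def]
  refine integral_congr_ae ?_
  filter_upwards [coeFn_mulIndicator hA f, coeFn_mulIndicator hA g] with x hf hg
  by_cases hm : x ∈ A <;> simp [hf, hg, hm]

end Operator

section Projection

theorem geoBall_subset_closedBall (P : S3) {r : ℝ} (hr : 0 ≤ r) : geoBall P r ⊆ closedBall P r := by
  intro x hx
  have hlt : InnerProductGeometry.angle (P : EuclideanSpace ℝ (Fin 4)) x < r := hx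
  have hnonneg := InnerProductGeometry.angle_nonneg (P : EuclideanSpace ℝ (Fin 4)) x
  have hcos := Real.one_sub_sq_div_two_le_cos
    (x := InnerProductGeometry.angle (P : EuclideanSpace ℝ (Fin 4)) x)
  have hdist := norm_sub_sq_real (x : EuclideanSpace ℝ (Fin 4)) P
  rw [InnerProductGeometry.cos_angle] at hcos
  simp only [norm_eq_of_mem_sphere, one_mul, div_one, real_inner_comm] at hcos hdist
  rw [mem_closedBall, Subtype.dist_eq, dist_eq_norm]
  exact abs_le_of_sq_le_sq' (by nlinarith) hr |>.2

theorem norm_sq_ballCutoff_le (P : S3) {r : ℝ} (hr : 0 < r) {d : ℕ} {f : L2}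
    (hf : f ∈ sphericalHarmonics d) : ‖ballCutoff P r f‖ ^ 2 ≤ 52 * r * ‖f‖ ^ 2 := by
  obtain ⟨p, hp, rfl⟩ := hf
  set f : L2 := ((ContinuousMap.toLp 2 surf ℂ).toLinearMap ∘ₗ polyRestrict) p
  have hsq : (fun x => ‖f x‖ ^ 2) =ᵐ[surf]
      fun x => Complex.reCLM (polyEval p x) ^ 2 + Complex.imCLM (polyEval p x) ^ 2 := by
    filter_upwards [ContinuousMap.coeFn_toLp (p := 2) (𝕜 := ℂ) surf (polyRestrict p)] with x hx
    rw [show f x = polyEval p x from hx, Complex.sq_norm, Complex.normSq_apply, ← sq, ← sq]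
    rfl
  have hint (L : ℂ →L[ℝ] ℝ) : Integrable (fun x : S3 => L (polyEval p x) ^ 2) surf :=
    integrable_toSphere_of_continuous
      (((L.continuous.comp (contDiff_polyEval p (n := 0)).continuous).comp
        continuous_subtype_val).pow 2)
  have hle (L : ℂ →L[ℝ] ℝ) : ∫ x : S3 in geoBall P r, L (polyEval p x) ^ 2 ∂surf ≤
      52 * r * ∫ x : S3, L (polyEval p x) ^ 2 ∂surf := by
    refine (setIntegral_mono_set (hint L).integrableOn (ae_of_all _ fun x => sq_nonneg _)
      (geoBall_subset_closedBall P hr.le).eventuallyLE).trans ?_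
    have hmass := (isSolidHarmonic_polyEval hp L).setIntegral_closedBall_sq_le (by simp) P hr
    norm_num at hmass
    exact hmass
  rw [ballCutoff, norm_sq_mulIndicator, norm_sq_eq_integral, integral_congr_ae hsq,
    integral_congr_ae (ae_restrict_of_ae hsq), integral_add (hint _) (hint _),
    integral_add (hint _).integrableOn (hint _).integrableOn, mul_add]
  exact add_le_add (hle _) (hle _)

theorem norm_ballCutoff_comp_starProjection_le (P : S3) {r : ℝ} (hr : 0 < r) (d : ℕ) :
    ‖ballCutoff P r ∘L (sphericalHarmonics d).starProjection‖ ≤ √(52 * r) := by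
  refine ContinuousLinearMap.opNorm_le_bound _ (Real.sqrt_nonneg _) fun f => ?_
  set g := (sphericalHarmonics d).starProjection f
  have hcutoff : ‖ballCutoff P r g‖ ≤ √(52 * r) * ‖g‖ := by
    rw [← Real.sqrt_sq (norm_nonneg g), ← Real.sqrt_mul (by positivity)]
    exact Real.le_sqrt_of_sq_le
      (norm_sq_ballCutoff_le P hr (Submodule.starProjection_apply_mem _ f))
  exact hcutoff.trans (by gcongr; exact Submodule.norm_starProjection_apply_le _ f)

end Projection

end SphereCluster

end

theorem lemma2p3_general :
    ∃ C : ℝ, 0 < C ∧ ∀ (P : SphereCluster.S3) (r : ℝ), 0 < r → ∀ d : ℕ,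
      ‖SphereCluster.ballCutoff P r ∘L (SphereCluster.sphericalHarmonics d).starProjection‖ =
          ‖(SphereCluster.sphericalHarmonics d).starProjection ∘L SphereCluster.ballCutoff P r‖ ∧
        ‖(SphereCluster.sphericalHarmonics d).starProjection ∘L SphereCluster.ballCutoff P r‖ ≤
          C * √r := by
  refine ⟨√52, by positivity, fun P r hr d => ?_⟩
  have hcomm := SphereCluster.norm_comp_comm_of_isSelfAdjoint
    (SphereCluster.isSelfAdjoint_mulIndicator (SphereCluster.measurableSet_geoBall P r))
    (isSelfAdjoint_starProjection (SphereCluster.sphericalHarmonics d))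
  refine ⟨hcomm, ?_⟩
  rw [← Real.sqrt_mul (by norm_num)]
  exact hcomm.ge.trans (SphereCluster.norm_ballCutoff_comp_starProjection_le P hr d)

theorem lemma2p3 :
    ∃ C : ℝ, 0 < C ∧ ∀ (N : ℕ), (∃ k : ℕ, N = 2 ^ k) → ∀ (P : SphereCluster.S3) (q : ℕ), 1 ≤ q →
      ‖SphereCluster.ballCutoff P (N : ℝ)⁻¹ ∘L SphereCluster.spectralProj q‖ =
          ‖SphereCluster.spectralProj q ∘L SphereCluster.ballCutoff P (N : ℝ)⁻¹‖ ∧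
        ‖SphereCluster.spectralProj q ∘L SphereCluster.ballCutoff P (N : ℝ)⁻¹‖ ≤
          C * ((N : ℝ) ^ (-(1 / 2) : ℝ) + (q : ℝ) ^ (-2 : ℝ)) := by
  obtain ⟨C, hC, hbound⟩ := lemma2p3_general
  refine ⟨C, hC, ?_⟩
  rintro N ⟨k, rfl⟩ P q -
  obtain ⟨hcomm, hle⟩ := hbound P ((2 ^ k : ℕ) : ℝ)⁻¹ (by positivity) (q - 1)
  rw [Real.sqrt_eq_rpow, Real.inv_rpow (by positivity), ← Real.rpow_neg (by positivity)] at hle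
  exact ⟨hcomm, hle.trans (by gcongr; exact le_add_of_nonneg_right (by positivity))⟩
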